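/- Let $G$ be a finitely generated group with a free subgroup $F$ of finite index (so $G$ is virtually free), let $H\le G$ be a subgroup and let $\varphi$ be an endomorphism of $G$. Write maps on the right: $G\varphi$ and $F\varphi$ are the images of $G$ and $F$, and $H\varphi^{-1}=\{g\in G : g\varphi\in H\}$. (a) If $\operatorname{Ker}(\varphi)$ is finite and $H$ is finitely generated, then $H\varphi^{-1}$ is finitely generated. (b) If $\operatorname{Ker}(\varphi)$ is infinite (and $H\le G$ is arbitrary), then the following six conditions are equivalent: 1. $H\varphi^{-1}$ is finitely generated; 2. $H\varphi^{-1}\cap F$ has finite index in $F$; 3. $H\varphi^{-1}\cap F$ has finite index in $G$; 4. $H\varphi^{-1}$ has finite index in $G$; 5. $H\cap G\varphi$ has finite index in $G\varphi$; 6. $H\cap F\varphi$ has finite index in $F\varphi$. -/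

import Mathlib

/-! ### Prefixes and core graphs in free groups -/

namespace FreeGroup

variable {α : Type*}

/-! For (a), `φ` maps the preimage of `H` onto `H ∩ Gφ` with finite kernel, so Howson's theorem
(`fg_inf`), extended to virtually free groups, suffices. For (b), the preimage contains the infinite
normal subgroup `Ker φ`, which meets `F` nontrivially; a finitely generated subgroup of a free group
containing a nontrivial normal subgroup has finite index (`finiteIndex_of_normal_le`). The other
equivalences are index arithmetic. Both free-group theorems rest on core graphs: in finite rank, a
subgroup is finitely generated iff its core is finite. -/

theorem prefix_append_cases {β : Type*} {P A B : List β} (h : P <+: A ++ B) :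
    P <+: A ∨ ∃ C, P = A ++ C ∧ C <+: B := by
  obtain ⟨Q, hQ⟩ := h
  rcases List.append_eq_append_iff.1 hQ with ⟨C, hC, _⟩ | ⟨C, hC, hB⟩
  · exact Or.inl ⟨C, hC.symm⟩
  · exact Or.inr ⟨C, hC, Q, hB.symm⟩

/-- Every vertex visited by a reduction of a word is visited by the word itself. -/
theorem Red.exists_prefix_mk_eq {L L' : List (α × Bool)} (h : Red L L') :
    ∀ P', P' <+: L' → ∃ P, P <+: L ∧ mk P = mk P' := by
  induction h with
  | refl => exact fun P' hP' => ⟨P', hP', rfl⟩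
  | tail _ hstep ih =>
    intro P' hP'
    suffices H : ∃ P, P <+: _ ∧ mk P = mk P' by
      obtain ⟨P, hP, e⟩ := H
      obtain ⟨Q, hQ, e'⟩ := ih P hP
      exact ⟨Q, hQ, e'.trans e⟩
    cases hstep with
    | @not A B x b =>
      rcases prefix_append_cases hP' with h | ⟨C, rfl, hC⟩
      · exact ⟨P', h.trans (List.prefix_append _ _), rfl⟩
      · refine ⟨A ++ (x, b) :: (x, !b) :: C, ?_, Quot.sound Red.Step.not⟩
        simpa using hC

variable [DecidableEq α]

/-- `p` lies on the geodesic from `1` to `g` in the Cayley tree of the free group. -/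
def IsPrefix (p g : FreeGroup α) : Prop := ∃ P, P <+: g.toWord ∧ mk P = p

theorem toWord_mk_of_prefix {P : List (α × Bool)} {g : FreeGroup α} (h : P <+: g.toWord) :
    (mk P).toWord = P := by
  rw [toWord_mk]
  exact (isReduced_toWord.infix h.isInfix).reduce_eq

theorem isPrefix_iff {p g : FreeGroup α} : IsPrefix p g ↔ p.toWord <+: g.toWord := by
  constructor
  · rintro ⟨P, h, rfl⟩
    rwa [toWord_mk_of_prefix h]
  · exact fun h => ⟨_, h, mk_toWord⟩

/-- In a tree, the geodesic `[1, ab]` lies in `[1, a] ∪ a[1, b]`. -/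
theorem IsPrefix.of_mul {p a b : FreeGroup α} (h : IsPrefix p (a * b)) :
    IsPrefix p a ∨ IsPrefix (a⁻¹ * p) b := by
  obtain ⟨P', hP', rfl⟩ := h
  rw [toWord_mul] at hP'
  obtain ⟨P, hP, e⟩ := Red.exists_prefix_mk_eq reduce.red P' hP'
  rcases prefix_append_cases hP with h | ⟨C, rfl, hC⟩
  · exact Or.inl ⟨P, h, e⟩
  · refine Or.inr ⟨C, hC, ?_⟩
    rw [← e, ← mul_mk, mk_toWord]
    group

theorem IsPrefix.mul_of_inv {p g : FreeGroup α} (h : IsPrefix p g⁻¹) : IsPrefix (g * p) g := by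
  obtain ⟨P, ⟨Q, hQ⟩, rfl⟩ := h
  refine ⟨invRev Q, ⟨invRev P, ?_⟩, ?_⟩
  · rw [← invRev_append, hQ, toWord_inv, invRev_invRev]
  · have h1 : mk P * mk Q = g⁻¹ := by rw [mul_mk, hQ, mk_toWord]
    rw [← inv_mk, eq_comm, ← inv_inv g, ← h1]
    group

theorem IsPrefix.norm_add {p g : FreeGroup α} (h : IsPrefix p g) :
    norm p + norm (p⁻¹ * g) = norm g := by
  obtain ⟨P, ⟨Q, hQ⟩, rfl⟩ := h
  have h1 : mk P * mk Q = g := by rw [mul_mk, hQ, mk_toWord]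
  have h2 : (mk P).toWord = P := toWord_mk_of_prefix ⟨Q, hQ⟩
  have h3 : (mk Q).toWord = Q := by
    rw [toWord_mk]
    exact (isReduced_toWord.infix (List.IsSuffix.isInfix ⟨P, hQ⟩)).reduce_eq
  rw [← h1, inv_mul_cancel_left, h1, norm, norm, norm, h2, h3, ← hQ, List.length_append]

theorem IsPrefix.eq_of_norm_eq {p q g : FreeGroup α} (hp : IsPrefix p g) (hq : IsPrefix q g)
    (h : norm p = norm q) : p = q := by
  rw [isPrefix_iff] at hp hq
  exact toWord_injective ((List.prefix_of_prefix_length_le hp hq h.le).eq_of_length h)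

theorem exists_isPrefix_norm_eq {g : FreeGroup α} {k : ℕ} (hk : k ≤ norm g) :
    ∃ p, IsPrefix p g ∧ norm p = k := by
  refine ⟨mk (g.toWord.take k), ⟨_, List.take_prefix _ _, rfl⟩, ?_⟩
  rw [norm, toWord_mk_of_prefix (List.take_prefix _ _), List.length_take]
  exact min_eq_left hk

theorem finite_setOf_isPrefix (g : FreeGroup α) : {p | IsPrefix p g}.Finite := by
  refine ((List.finite_toSet g.toWord.inits).image mk).subset ?_
  rintro _ ⟨P, hP, rfl⟩
  exact ⟨P, by simpa using hP, rfl⟩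

theorem finite_setOf_norm_le [Finite α] (n : ℕ) : {g : FreeGroup α | norm g ≤ n}.Finite :=
  (List.finite_length_le (α × Bool) n).of_injOn (f := toWord) (fun _ h => h)
    toWord_injective.injOn

/-- The vertices of the Stallings core graph of `H`, where the coset `H p` is encoded by the
left coset of `p⁻¹`. -/
def coreVertices (H : Subgroup (FreeGroup α)) : Set (FreeGroup α ⧸ H) :=
  {c | ∃ h ∈ H, ∃ p, IsPrefix p h ∧ c = ((p⁻¹ : FreeGroup α) : FreeGroup α ⧸ H)}

/-- By `IsPrefix.of_mul`, prefixes of products are, modulo `H`, prefixes of the factors, so only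
generators contribute. -/
theorem finite_coreVertices_of_fg {H : Subgroup (FreeGroup α)} (hH : H.FG) :
    (coreVertices H).Finite := by
  obtain ⟨S, hS⟩ := hH
  let C : Set (FreeGroup α ⧸ H) :=
    ⋃ s ∈ S, (fun p : FreeGroup α => ((p⁻¹ : FreeGroup α) : FreeGroup α ⧸ H)) '' {p | IsPrefix p s}
  have hC : C.Finite :=
    S.finite_toSet.biUnion fun s _ => (finite_setOf_isPrefix s).image _
  have key : ∀ a ∈ H, ∀ p : FreeGroup α, ((((a * p)⁻¹ : FreeGroup α)) : FreeGroup α ⧸ H) =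
      ((p⁻¹ : FreeGroup α) : FreeGroup α ⧸ H) := by
    intro a ha p
    rw [QuotientGroup.eq]
    simpa using ha
  have main : ∀ h ∈ H, ∀ p, IsPrefix p h → ((p⁻¹ : FreeGroup α) : FreeGroup α ⧸ H) ∈
      insert ((1 : FreeGroup α) : FreeGroup α ⧸ H) C := by
    intro h hh
    rw [← hS] at hh
    induction hh using Subgroup.closure_induction with
    | mem s hs => exact fun p hp => Or.inr (Set.mem_biUnion hs ⟨p, hp, rfl⟩)
    | one =>
      intro p hp
      rw [isPrefix_iff, toWord_one, List.prefix_nil, toWord_eq_nil_iff] at hp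
      simp [hp]
    | mul a b ha hb iha ihb =>
      intro p hp
      rw [hS] at ha
      rcases hp.of_mul with h | h
      · exact iha p h
      · rw [← key _ (inv_mem ha)]
        exact ihb _ h
    | inv a ha iha =>
      intro p hp
      rw [hS] at ha
      rw [← key _ ha]
      exact iha _ hp.mul_of_inv
  refine (hC.insert ((1 : FreeGroup α) : FreeGroup α ⧸ H)).subset ?_
  rintro _ ⟨h, hh, p, hp, rfl⟩
  exact main h hh p hp

/-- Reading a word of `H` as a path in the core factors it into Schreier generators, one per edge.
-/
theorem fg_of_finite_coreVertices [Finite α] {H : Subgroup (FreeGroup α)}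
    (hH : (coreVertices H).Finite) : H.FG := by
  let r : FreeGroup α ⧸ H → FreeGroup α := fun c => (Quotient.out c)⁻¹
  let v : List (α × Bool) → FreeGroup α ⧸ H :=
    fun P => (((mk P)⁻¹ : FreeGroup α) : FreeGroup α ⧸ H)
  have hr : ∀ g : FreeGroup α, g * (r ((g⁻¹ : FreeGroup α) : FreeGroup α ⧸ H))⁻¹ ∈ H := by
    intro g
    have h := QuotientGroup.out_eq' ((g⁻¹ : FreeGroup α) : FreeGroup α ⧸ H)
    rw [QuotientGroup.eq] at h
    simpa [r] using inv_mem h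
  let f : (FreeGroup α ⧸ H) × (FreeGroup α ⧸ H) × (α × Bool) → FreeGroup α :=
    fun t => r t.1 * mk [t.2.2] * (r t.2.1)⁻¹
  let T : Set (FreeGroup α) := f '' (coreVertices H ×ˢ coreVertices H ×ˢ Set.univ) ∩ H
  have hT : T.Finite := ((hH.prod (hH.prod Set.finite_univ)).image f).subset Set.inter_subset_left
  have hmem : ∀ h ∈ H, ∀ P, P <+: h.toWord → v P ∈ coreVertices H :=
    fun h hh P hP => ⟨h, hh, mk P, ⟨P, hP, rfl⟩, rfl⟩
  have main : ∀ h ∈ H, ∀ P, P <+: h.toWord →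
      r (v []) * mk P * (r (v P))⁻¹ ∈ Subgroup.closure T := by
    intro h hh P
    induction P using List.reverseRecOn with
    | nil =>
      intro _
      rw [← one_eq_mk, mul_one, mul_inv_cancel]
      exact one_mem _
    | append_singleton P x ih =>
      intro hP
      have hP' : P <+: h.toWord := (List.prefix_append _ _).trans hP
      have e : r (v []) * mk (P ++ [x]) * (r (v (P ++ [x])))⁻¹ =
          r (v []) * mk P * (r (v P))⁻¹ * (r (v P) * mk [x] * (r (v (P ++ [x])))⁻¹) := by
        rw [← mul_mk]; group
      rw [e]
      refine mul_mem (ih hP') (Subgroup.subset_closure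
        ⟨⟨(v P, v (P ++ [x]), x), ⟨hmem h hh _ hP', hmem h hh _ hP, trivial⟩, rfl⟩, ?_⟩)
      have e' : r (v P) * mk [x] * (r (v (P ++ [x])))⁻¹ =
          (mk P * (r (v P))⁻¹)⁻¹ * (mk (P ++ [x]) * (r (v (P ++ [x])))⁻¹) := by
        rw [← mul_mk]; group
      rw [e']
      exact mul_mem (inv_mem (hr _)) (hr _)
  have h0 : r (v []) ∈ H := by
    have := hr 1
    rw [one_mul, inv_mem_iff] at this
    exact this
  have hv : ∀ h ∈ H, v h.toWord = v [] := by
    intro h hh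
    simp only [v, mk_toWord, ← one_eq_mk]
    rw [QuotientGroup.eq]
    simpa using hh
  rw [Subgroup.fg_iff]
  refine ⟨T, le_antisymm ((Subgroup.closure_le _).2 Set.inter_subset_right) fun h hh => ?_, hT⟩
  -- The chosen representative of the base vertex need not be `1`; conjugating compensates.
  have hh' : (r (v []))⁻¹ * h * r (v []) ∈ H := mul_mem (mul_mem (inv_mem h0) hh) h0
  have := main _ hh' _ (List.prefix_refl _)
  rw [hv _ hh', mk_toWord] at this
  convert this using 1
  group

/-- **Howson's theorem** for free groups of finite rank. -/
theorem fg_inf [Finite α] {H K : Subgroup (FreeGroup α)} (hH : H.FG) (hK : K.FG) :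
    (H ⊓ K).FG := by
  -- The core of `H ⊓ K` embeds in the product of the two cores.
  refine fg_of_finite_coreVertices <| ((finite_coreVertices_of_fg hH).prod
    (finite_coreVertices_of_fg hK)).of_injOn
    (f := fun c => (Subgroup.quotientMapOfLE inf_le_left c, Subgroup.quotientMapOfLE inf_le_right c))
    ?_ ?_
  · rintro _ ⟨h, hh, p, hp, rfl⟩
    exact ⟨⟨h, hh.1, p, hp, rfl⟩, ⟨h, hh.2, p, hp, rfl⟩⟩
  · refine Function.Injective.injOn ?_
    intro a b
    refine Quotient.inductionOn₂' a b fun x y h => ?_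
    obtain ⟨h1, h2⟩ := Prod.mk.inj h
    exact QuotientGroup.eq.2 ⟨QuotientGroup.eq.1 h1, QuotientGroup.eq.1 h2⟩

/-- A finitely generated subgroup of a free group of finite rank that contains a nontrivial normal
subgroup has finite index. -/
theorem finiteIndex_of_normal_le [Finite α] {N H : Subgroup (FreeGroup α)} [N.Normal]
    (hN : N ≠ ⊥) (hNH : N ≤ H) (hH : H.FG) : H.FiniteIndex := by
  obtain ⟨n, hn, hn1⟩ := N.bot_or_exists_ne_one.resolve_left hN
  let m := norm n
  let A : Set (FreeGroup α ⧸ H) :=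
    (fun u : FreeGroup α => ((u⁻¹ : FreeGroup α) : FreeGroup α ⧸ H)) '' {u | norm u ≤ m}
  let B : Set (FreeGroup α ⧸ H) :=
    Set.image2 (fun (w : FreeGroup α) c => w⁻¹ • c) {w | norm w ≤ m + 1} (coreVertices H)
  have hfin : (A ∪ B).Finite := ((finite_setOf_norm_le m).image _).union
    ((finite_setOf_norm_le (m + 1)).image2 _ (finite_coreVertices_of_fg hH))
  suffices h : A ∪ B = Set.univ by
    rw [h, Set.finite_univ_iff] at hfin
    exact Subgroup.finiteIndex_of_finite_quotient
  refine Set.eq_univ_of_forall fun c => ?_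
  obtain ⟨u, hu, hmin⟩ := (measure (norm (α := α))).wf.has_min
    {u | c = ((u⁻¹ : FreeGroup α) : FreeGroup α ⧸ H)}
    ⟨c.out⁻¹, by simp⟩
  have hmin' : ∀ h ∈ H, norm u ≤ norm (h * u) := by
    intro h hh
    refine not_lt.1 (hmin (h * u) ?_)
    refine Eq.trans (b := ((u⁻¹ : FreeGroup α) : FreeGroup α ⧸ H)) hu ?_
    rw [QuotientGroup.eq]
    simpa using hh
  by_cases hum : norm u ≤ m
  · exact Or.inl ⟨u, hum, hu.symm⟩
  -- With `u` shortest in `Hu`, the point `v` lies `m + 1` steps before its end, out of reach of a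
  -- final segment of length `m`.
  obtain ⟨v, hv, hvn⟩ := exists_isPrefix_norm_eq (g := u) (k := norm u - (m + 1)) (by omega)
  obtain ⟨w, rfl⟩ : ∃ w, u = v * w := ⟨v⁻¹ * u, by group⟩
  have hw : norm w = m + 1 := by
    have := hv.norm_add
    rw [inv_mul_cancel_left] at this
    omega
  have hg : v * w * n * (v * w)⁻¹ ∈ H := hNH (Subgroup.Normal.conj_mem ‹_› n hn _)
  set g := v * w * n * (v * w)⁻¹ with hgdef
  have hgu : g⁻¹ * (v * w * n) = v * w := by rw [hgdef]; group
  have hv' : IsPrefix v (g⁻¹ * (v * w * n)) := by rwa [hgu]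
  -- Since `u = g⁻¹ · u · n`, `v` lies on one of three segments. On the first, `v` gives a core
  -- vertex, so `u` is within `m + 1` of the core.
  rcases hv'.of_mul with h | h
  · refine Or.inr ⟨w, hw.le, _, ⟨g⁻¹, inv_mem hg, v, h, rfl⟩, ?_⟩
    refine Eq.trans ?_ hu.symm
    simp
  rw [inv_inv] at h
  rcases h.of_mul with h | h
  -- Both `v` and `gv` are prefixes of `u`. Minimality against `gu` forces `gv` to be the longer,
  -- and then `g⁻¹u` is shorter than `u`.
  · exfalso
    have h1 := h.norm_add
    have h2 := hmin' g hg
    rw [← mul_assoc] at h2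
    have h2' := norm_mul_le (g * v) w
    have h3 : norm (g * v) ≠ norm v := by
      intro e
      have := h.eq_of_norm_eq hv e
      rw [mul_eq_right, hgdef, mul_inv_eq_one, mul_eq_left] at this
      exact hn1 this
    have h4 := hmin' g⁻¹ (inv_mem hg)
    have h5 : g⁻¹ * (v * w) = v * ((g * v)⁻¹ * (v * w)) := by group
    rw [h5] at h4
    have h6 := norm_mul_le v ((g * v)⁻¹ * (v * w))
    omega
  -- Here `w` would be a terminal segment of `n`, yet it has length `m + 1`.
  · exfalso
    have e : (v * w)⁻¹ * (g * v) = n * w⁻¹ := by rw [hgdef]; group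
    rw [e] at h
    have h1 := h.norm_add
    have e' : (n * w⁻¹)⁻¹ * n = w := by group
    rw [e'] at h1
    omega

theorem finite_of_group_fg (α : Type*) [Group.FG (FreeGroup α)] : Finite α := by
  have : Group.FG (Abelianization (FreeGroup α)) :=
    Group.fg_of_surjective (f := Abelianization.of) (QuotientGroup.mk'_surjective _)
  have : AddGroup.FG (FreeAbelianGroup α) := GroupFG.iff_add_fg.1 this
  have : Module.Finite ℤ (FreeAbelianGroup α) := Module.Finite.iff_addGroup_fg.2 this
  exact Module.Finite.finite_basis (FreeAbelianGroup.basis α)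

end FreeGroup

/-! ### Finite generation under maps, finite index and finite kernels -/

namespace Subgroup

variable {G : Type*} [Group G]

theorem FG.map_hom {G' : Type*} [Group G'] {H : Subgroup G} (h : H.FG) (f : G →* G') :
    (H.map f).FG :=
  (Group.fg_iff_subgroup_fg _).1 <|
    have := (Group.fg_iff_subgroup_fg _).2 h
    Group.fg_of_surjective (f.subgroupMap_surjective H)

theorem FG.of_map_injective {G' : Type*} [Group G'] {f : G →* G'} (hf : Function.Injective f)
    {H : Subgroup G} (h : (H.map f).FG) : H.FG :=
  (Group.fg_iff_subgroup_fg H).1 <|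
    have := (Group.fg_iff_subgroup_fg _).2 h
    Group.fg_of_surjective (f := (H.equivMapOfInjective f hf).symm.toMonoidHom)
      (H.equivMapOfInjective f hf).symm.surjective

theorem FG.inf_of_relIndex_ne_zero {H K : Subgroup G} (hH : H.FG) (hK : K.relIndex H ≠ 0) :
    (H ⊓ K).FG := by
  have := (Group.fg_iff_subgroup_fg H).2 hH
  have : (K.subgroupOf H).FiniteIndex := ⟨hK⟩
  have h := (Group.fg_iff_subgroup_fg (K.subgroupOf H)).1 inferInstance
  have h' := h.map_hom H.subtype
  rwa [subgroupOf_map_subtype, inf_comm] at h'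

theorem FG.of_relIndex_ne_zero {H K : Subgroup G} (hK : K.FG) (hKH : K ≤ H)
    (h : K.relIndex H ≠ 0) : H.FG := by
  obtain ⟨S, hS, hSfin⟩ := (fg_iff K).1 hK
  have : (K.subgroupOf H).FiniteIndex := ⟨h⟩
  let R : Set G := Set.range fun c : H ⧸ K.subgroupOf H => (c.out : G)
  refine (fg_iff H).2 ⟨S ∪ R, le_antisymm ((closure_le _).2 ?_) fun x hx => ?_,
    hSfin.union (Set.finite_range _)⟩
  · rintro x (hx | ⟨c, rfl⟩)
    · exact hKH (hS ▸ subset_closure hx)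
    · exact c.out.2
  · have hK' : K ≤ closure (S ∪ R) := hS ▸ closure_mono Set.subset_union_left
    let c : H ⧸ K.subgroupOf H := ((⟨x, hx⟩ : H) : H ⧸ K.subgroupOf H)
    have hc : (c.out : G)⁻¹ * x ∈ K := by
      have := QuotientGroup.out_eq' c
      rw [QuotientGroup.eq] at this
      exact this
    have := mul_mem (subset_closure (Or.inr ⟨c, rfl⟩) : (c.out : G) ∈ closure (S ∪ R)) (hK' hc)
    rwa [mul_inv_cancel_left] at this

theorem FG.of_map_of_finite_ker {G' : Type*} [Group G'] {f : G →* G'} [Finite f.ker]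
    {H : Subgroup G} (hf : f.ker ≤ H) (h : (H.map f).FG) : H.FG := by
  obtain ⟨S, hS, hSfin⟩ := (fg_iff _).1 h
  have hSH : ∀ s ∈ S, ∃ x ∈ H, f x = s := fun s hs => by
    have : s ∈ H.map f := hS ▸ subset_closure hs
    exact this
  choose! r hrH hr using hSH
  refine (fg_iff H).2 ⟨r '' S ∪ f.ker, le_antisymm ((closure_le _).2 ?_) fun x hx => ?_,
    (hSfin.image _).union (Set.toFinite _)⟩
  · rintro _ (⟨s, hs, rfl⟩ | hx)
    · exact hrH s hs
    · exact hf hx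
  · have hS' : H.map f ≤ (closure (r '' S ∪ f.ker)).map f := by
      rw [← hS, closure_le]
      exact fun s hs => ⟨r s, subset_closure (Or.inl ⟨s, hs, rfl⟩), hr s hs⟩
    obtain ⟨y, hy, hyx⟩ := hS' ⟨x, hx, rfl⟩
    have : y⁻¹ * x ∈ f.ker := by rw [MonoidHom.mem_ker, map_mul, map_inv, hyx, inv_mul_cancel]
    have := mul_mem hy (subset_closure (Or.inr this))
    rwa [mul_inv_cancel_left] at this

end Subgroup

/-! ### Transfer to abstract free groups -/

namespace IsFreeGroup

variable {F : Type*} [Group F] [IsFreeGroup F] [Group.FG F]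

theorem finite_generators : Finite (Generators F) :=
  have : Group.FG (FreeGroup (Generators F)) :=
    Group.fg_of_surjective (f := (toFreeGroup F).toMonoidHom) (toFreeGroup F).surjective
  FreeGroup.finite_of_group_fg _

/-- **Howson's theorem**. -/
theorem fg_inf {H K : Subgroup F} (hH : H.FG) (hK : K.FG) : (H ⊓ K).FG := by
  classical
  have := finite_generators (F := F)
  refine Subgroup.FG.of_map_injective (f := (toFreeGroup F).toMonoidHom)
    (toFreeGroup F).injective ?_
  rw [Subgroup.map_inf _ _ _ (toFreeGroup F).injective]
  exact FreeGroup.fg_inf (hH.map_hom _) (hK.map_hom _)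

theorem finiteIndex_of_normal_le {N H : Subgroup F} [hn : N.Normal] (hN : N ≠ ⊥) (hNH : N ≤ H)
    (hH : H.FG) : H.FiniteIndex := by
  classical
  have := finite_generators (F := F)
  let e := (toFreeGroup F).toMonoidHom
  have he : Function.Injective e := (toFreeGroup F).injective
  have : (N.map e).Normal := hn.map e (toFreeGroup F).surjective
  have h := FreeGroup.finiteIndex_of_normal_le (N := N.map e) (H := H.map e)
    (by rwa [Ne, Subgroup.map_eq_bot_iff_of_injective _ he]) (Subgroup.map_mono hNH) (hH.map_hom e)
  rw [Subgroup.finiteIndex_iff] at h ⊢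
  rwa [Subgroup.index_map_of_bijective (toFreeGroup F).bijective] at h

end IsFreeGroup

/-! ### Virtually free groups -/

namespace Subgroup

variable {G : Type*} [Group G] [Group.FG G]

/-- Howson's theorem for virtually free groups. -/
theorem fg_inf_of_virtuallyFree (F : Subgroup G) [IsFreeGroup F] [F.FiniteIndex]
    {H K : Subgroup G} (hH : H.FG) (hK : K.FG) : (H ⊓ K).FG := by
  have key : ∀ L : Subgroup G, L.FG → (L.subgroupOf F).FG := fun L hL => by
    refine FG.of_map_injective F.subtype_injective ?_
    rw [subgroupOf_map_subtype]
    exact hL.inf_of_relIndex_ne_zero fun h =>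
      F.index_ne_zero_of_finite (index_eq_zero_of_relIndex_eq_zero h)
  have h := (IsFreeGroup.fg_inf (key H hH) (key K hK)).map_hom F.subtype
  simp only [subgroupOf] at h
  rw [← comap_inf, ← subgroupOf, subgroupOf_map_subtype] at h
  -- `H ⊓ K ⊓ F` has finite index in `H ⊓ K`.
  refine h.of_relIndex_ne_zero inf_le_left ?_
  rw [inf_relIndex_left]
  exact fun h => F.index_ne_zero_of_finite (index_eq_zero_of_relIndex_eq_zero h)

/-- In a finitely generated virtually free group, a finitely generated subgroup containing an
infinite normal subgroup has finite index in the free subgroup. -/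
theorem relIndex_ne_zero_of_infinite_normal_le (F : Subgroup G) [IsFreeGroup F] [F.FiniteIndex]
    {N H : Subgroup G} [N.Normal] [Infinite N] (hNH : N ≤ H) (hH : H.FG) : H.relIndex F ≠ 0 := by
  have hF : ∀ L : Subgroup G, F.relIndex L ≠ 0 := fun L h =>
    F.index_ne_zero_of_finite (index_eq_zero_of_relIndex_eq_zero h)
  have hHF : (H.subgroupOf F).FG := by
    refine FG.of_map_injective F.subtype_injective ?_
    rw [subgroupOf_map_subtype]
    exact hH.inf_of_relIndex_ne_zero (hF H)
  have hN : N.subgroupOf F ≠ ⊥ := by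
    intro h
    rw [subgroupOf_eq_bot, disjoint_iff] at h
    -- If `N ∩ F` were trivial, the index of `F` relative to `N` would be `Nat.card N`, which is `0`
    -- as `N` is infinite.
    have := hF N
    rw [← inf_relIndex_right, inf_comm, h, relIndex_bot_left] at this
    exact this Nat.card_eq_zero_of_infinite
  exact (IsFreeGroup.finiteIndex_of_normal_le hN (comap_mono hNH) hHF).index_ne_zero

end Subgroup

theorem proposition5p11 {G : Type*} [Group G] [Group.FG G]
    (F : Subgroup G) [IsFreeGroup F] [F.FiniteIndex]
    (H : Subgroup G) (φ : G →* G) :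
    (Finite φ.ker → H.FG → (H.comap φ).FG) ∧
    (Infinite φ.ker →
      List.TFAE [
        (H.comap φ).FG,
        ((H.comap φ ⊓ F).subgroupOf F).FiniteIndex,
        (H.comap φ ⊓ F).FiniteIndex,
        (H.comap φ).FiniteIndex,
        ((H ⊓ φ.range).subgroupOf φ.range).FiniteIndex,
        ((H ⊓ F.map φ).subgroupOf (F.map φ)).FiniteIndex]) := by
  have hker : φ.ker ≤ H.comap φ := Subgroup.comap_mono bot_le
  refine ⟨fun _ hH => ?_, fun _ => ?_⟩
  · refine Subgroup.FG.of_map_of_finite_ker (f := φ) hker ?_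
    rw [Subgroup.map_comap_eq, inf_comm]
    exact Subgroup.fg_inf_of_virtuallyFree F hH
      ((Group.fg_iff_subgroup_fg _).1 (Group.fg_of_surjective φ.rangeRestrict_surjective))
  · have hF : F.index ≠ 0 := Subgroup.FiniteIndex.index_ne_zero
    simp only [Subgroup.inf_subgroupOf_right]
    simp only [Subgroup.finiteIndex_iff]
    tfae_have 1 → 2 := fun h => Subgroup.relIndex_ne_zero_of_infinite_normal_le F hker h
    tfae_have 2 → 3 := fun h => by
      rw [← Subgroup.relIndex_mul_index (inf_le_right : H.comap φ ⊓ F ≤ F),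
        Subgroup.inf_relIndex_right]
      exact mul_ne_zero h hF
    tfae_have 3 → 4 := fun h => ne_zero_of_dvd_ne_zero h (Subgroup.index_dvd_of_le inf_le_left)
    tfae_have 4 → 1 := fun h =>
      have : (H.comap φ).FiniteIndex := ⟨h⟩
      (Group.fg_iff_subgroup_fg _).1 inferInstance
    tfae_have 4 ↔ 5 := by rw [Subgroup.index_comap, Subgroup.relIndex]
    tfae_have 2 ↔ 6 := by
      rw [← Subgroup.relIndex, ← Subgroup.relIndex, Subgroup.relIndex_comap]
    tfae_finish
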